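/- For graphs $H_1,H_2$, the Ramsey number $R(H_1,H_2)$ is the smallest $N$ such that every 2-coloring of the edges of the complete graph $K_N$ contains a copy of $H_1$ in color 1 or a copy of $H_2$ in color 2. Let $K_{1,m}$ be the star with $m$ edges, and let $F_n$ be the fan on $2n+1$ vertices consisting of $n$ triangles meeting at a single vertex. For all integers $n$ and $m$ with $m>n\ge 2$, $$\frac{3m+\sqrt{m^2+8n^2}}{2}-8<R(K_{1,m},F_n)<\frac{3m+\sqrt{m^2+8n^2}}{2}+1.$$ In particular, for all integers $n\ge 2$, $(3+\sqrt3)n-8<R(K_{1,2n},F_n)<(3+\sqrt3)n+1$. -/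

import Mathlib

open scoped SimpleGraph

/-- The star `K_{1,m}`. -/
abbrev starK (m : ℕ) : SimpleGraph (Fin 1 ⊕ Fin m) :=
  completeBipartiteGraph (Fin 1) (Fin m)

/-- The fan `F_n`: the vertex `none` joined to the perfect matching of size `n` whose `i`-th edge
is `{some (i, false), some (i, true)}`; that is, `n` triangles meeting at the vertex `none`. -/
def fan (n : ℕ) : SimpleGraph (Option (Fin n × Bool)) where
  Adj x y := x ≠ y ∧
    (x = none ∨ y = none ∨ ∃ (i : Fin n) (a b : Bool), x = some (i, a) ∧ y = some (i, b))
  symm := ⟨by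
    rintro x y ⟨hne, h⟩
    refine ⟨hne.symm, ?_⟩
    rcases h with h | h | ⟨i, a, b, hx, hy⟩
    · exact Or.inr (Or.inl h)
    · exact Or.inl h
    · exact Or.inr (Or.inr ⟨i, b, a, hy, hx⟩)⟩
  loopless := ⟨fun _ h => h.1 rfl⟩

/-- Every 2-coloring of the edges of `K_N` contains a copy of `H₁` in color 1 or a copy of `H₂` in
color 2. A 2-coloring is given by the graph `G` of the edges of color 1; the edges of color 2 are
then those of the complement `Gᶜ`. -/
def RamseyArrow {V W : Type*} (H₁ : SimpleGraph V) (H₂ : SimpleGraph W) (N : ℕ) : Prop :=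
  ∀ G : SimpleGraph (Fin N), H₁ ⊑ G ∨ H₂ ⊑ Gᶜ

/-- The Ramsey number `R(H₁, H₂)`: the smallest `N` with `RamseyArrow H₁ H₂ N`. -/
noncomputable def ramseyNumber {V W : Type*} (H₁ : SimpleGraph V) (H₂ : SimpleGraph W) : ℕ :=
  sInf {N : ℕ | RamseyArrow H₁ H₂ N}

/-! Let `H` be the second color. A coloring without a `K_{1,m}` means that every vertex has at most
`m` non-neighbors in `H`, itself included. A fan `F_n` in `H` is a neighborhood containing `n`
disjoint edges.

Upper bound. Let `N = 2m + D` with `(m + D) D ≥ 2n²`, and suppose that no neighborhood has `n`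
disjoint edges. By Tutte–Berge each neighborhood contains a set `W` splitting into many odd
components. They cannot all be large, so one is a single vertex `z`, which forces `|W| ≤ m`. One
representative per odd component gives a large independent set `J` in which each vertex of `W` has
at most one neighbor (`exists_independent_of_not_hasMatching`). Doing this in `N(x)` and then in
`N(z)` gives disjoint `W₁`, `W₂` with independent sets `J`, `I`. Counting the edges at `I ∪ J`
contradicts the minimum degree: vertices of `W₁` and `W₂` send few edges there by construction, and
any other vertex does so because `I` and `J` are joined by many disjoint edges (`count_edges`,
`false_of_count`).

Lower bound. `doubledGraph` takes two copies of a nearly biregular bipartite graph with sides `P`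
and `q`, and joins each `P`-side to everything opposite except that the two `q`-sides stay
nonadjacent. The edges in each neighborhood have a vertex cover of size `n - 1`, and optimizing `P`
and `q` leaves only rounding losses.

Both bounds meet at the root of `(X - m)(X - 2m) = 2n²`, which is `X = (3m + √(m² + 8n²)) / 2`. -/

/-! ### Matchings inside a vertex set and the Tutte–Berge formula -/

/-- `A` contains `n` pairwise disjoint edges of `H`. -/
def HasMatching {V : Type*} (H : SimpleGraph V) (A : Finset V) (n : ℕ) : Prop :=
  ∃ f : Fin n × Bool → V, Function.Injective f ∧ (∀ p, f p ∈ A) ∧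
    ∀ i, H.Adj (f (i, false)) (f (i, true))

/-- The join of the graph induced by `H` on `A` with a complete graph on `t` vertices. -/
def joinComplete {V : Type*} (H : SimpleGraph V) (A : Finset V) (t : ℕ) :
    SimpleGraph (A ⊕ Fin t) where
  Adj
    | .inl a, .inl b => H.Adj a b
    | .inr i, .inr j => i ≠ j
    | _, _ => True
  symm := ⟨by
    rintro (a | i) (b | j) h
    · exact SimpleGraph.Adj.symm h
    · trivial
    · trivial
    · exact Ne.symm h⟩
  loopless := ⟨by
    rintro (a | i) h
    · exact H.loopless.irrefl _ h
    · exact h rfl⟩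

lemma joinComplete_adj_inr {V : Type*} (H : SimpleGraph V) (A : Finset V) (t : ℕ)
    (x : A ⊕ Fin t) (k : Fin t) (h : x ≠ .inr k) : (joinComplete H A t).Adj x (.inr k) := by
  rcases x with a | i
  · trivial
  · exact fun e => h (by rw [e])

/-- A fixed-point free partial involution along edges yields a matching. -/
lemma hasMatching_of_involution {V : Type*} [LinearOrder V] (H : SimpleGraph V)
    (A X : Finset V) (n : ℕ) (f : V → V) (hXA : X ⊆ A) (hX : 2 * n ≤ X.card)
    (hf : ∀ x ∈ X, f x ∈ X ∧ f (f x) = x ∧ H.Adj x (f x)) : HasMatching H A n := by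
  -- The order selects one endpoint of each edge `{x, f x}`.
  set Y := X.filter (fun x => x < f x) with hY
  have hle : (X \ Y).card ≤ Y.card := by
    apply Finset.card_le_card_of_injOn f
    · intro x hx
      simp only [hY, Finset.coe_sdiff, Finset.coe_filter, Set.mem_sdiff, Finset.mem_coe,
        Set.mem_ofPred_eq, not_and, not_lt] at hx ⊢
      obtain ⟨h1, h2, h3⟩ := hf x hx.1
      refine ⟨h1, ?_⟩
      rw [h2]
      exact lt_of_le_of_ne (hx.2 hx.1) h3.ne'
    · intro x hx y hy hxy
      simp only [Finset.coe_sdiff, Set.mem_sdiff, Finset.mem_coe] at hx hy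
      rw [← (hf x hx.1).2.1, hxy, (hf y hy.1).2.1]
  have hYX : Y ⊆ X := Finset.filter_subset _ _
  have := Finset.card_sdiff_add_card_eq_card hYX
  have hn : Fintype.card (Fin n) ≤ Fintype.card Y := by simp; omega
  obtain ⟨g⟩ := Function.Embedding.nonempty_of_card_le hn
  have hg : ∀ i, (g i : V) ∈ X ∧ (g i : V) < f (g i) := fun i =>
    Finset.mem_filter.1 (g i).2
  refine ⟨fun p => if p.2 then f (g p.1) else g p.1, ?_, ?_, ?_⟩
  · rintro ⟨i, a⟩ ⟨j, b⟩ h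
    obtain ⟨hi, hi'⟩ := hg i
    obtain ⟨hj, hj'⟩ := hg j
    cases a <;> cases b <;> simp only [Bool.false_eq_true, if_false, if_true] at h
    · rw [g.injective (Subtype.ext h)]
    · rw [h, (hf _ hj).2.1] at hi'
      exact absurd hj' (not_lt.2 hi'.le)
    · rw [← h, (hf _ hi).2.1] at hj'
      exact absurd hi' (not_lt.2 hj'.le)
    · have : (g i : V) = g j := by rw [← (hf _ hi).2.1, h, (hf _ hj).2.1]
      rw [g.injective (Subtype.ext this)]
  · rintro ⟨i, a⟩
    cases a
    · simpa using hXA (hg i).1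
    · simpa using hXA (hf _ (hg i).1).1
  · intro i
    simpa using (hf _ (hg i).1).2.2

/-- At most `t` vertices of `A` are matched to added vertices, so at least `2n` are matched among
themselves. -/
lemma hasMatching_of_isPerfectMatching {V : Type*} [LinearOrder V] (H : SimpleGraph V)
    (A : Finset V) (n t : ℕ) (hA : A.card = 2 * n + t)
    (M : (joinComplete H A t).Subgraph) (hM : M.IsPerfectMatching) : HasMatching H A n := by
  classical
  rw [SimpleGraph.Subgraph.isPerfectMatching_iff] at hM
  choose f hf hf' using hM
  have hinv : ∀ v, f (f v) = v := fun v => (hf' _ _ (hf v).symm).symm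
  let X : Finset A := Finset.univ.filter (fun a => (f (.inl a)).isLeft)
  let F : V → V := fun v =>
    if h : v ∈ A then Sum.elim (fun a : A => (a : V)) (fun _ => v) (f (.inl ⟨v, h⟩)) else v
  have hXc : (Finset.univ \ X).card ≤ t := by
    have : ∀ a : A, a ∈ Finset.univ \ X → ∃ k : Fin t, f (.inl a) = .inr k := by
      intro a ha
      simp only [X, Finset.mem_sdiff, Finset.mem_univ, Finset.mem_filter, true_and] at ha
      rcases h : f (.inl a) with b | k
      · simp [h] at ha
      · exact ⟨k, rfl⟩
    calc (Finset.univ \ X).card ≤ ((Finset.univ : Finset (Fin t)).map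
            (Function.Embedding.inr : Fin t ↪ A ⊕ Fin t)).card := by
          apply Finset.card_le_card_of_injOn (fun a => f (.inl a))
          · intro a ha
            obtain ⟨k, hk⟩ := this a ha
            simp [hk]
          · intro a ha b hb hab
            have := congrArg f hab
            simp only [hinv] at this
            exact Sum.inl_injective this
      _ = t := by simp
  refine hasMatching_of_involution H A (X.map (Function.Embedding.subtype _)) n F ?_ ?_ ?_
  · intro x hx
    simp only [Finset.mem_map, Function.Embedding.subtype_apply] at hx
    obtain ⟨a, -, rfl⟩ := hx
    exact a.2
  · rw [Finset.card_map]
    have := Finset.card_sdiff_add_card_eq_card (Finset.subset_univ X)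
    rw [Finset.card_univ, Fintype.card_coe] at this
    omega
  · intro x hx
    simp only [Finset.mem_map, Function.Embedding.subtype_apply] at hx
    obtain ⟨a, ha, rfl⟩ := hx
    simp only [X, Finset.mem_filter, Finset.mem_univ, true_and] at ha
    rcases h : f (.inl a) with b | k
    · have hFa : F a = b := by simp [F, h]
      have hb : f (.inl b) = .inl a := by rw [← h, hinv]
      have hFb : F b = a := by simp [F, hb]
      rw [hFa, hFb]
      refine ⟨?_, rfl, ?_⟩
      · simp [X, hb]
      · have := (hf (.inl a)).adj_sub
        rw [h] at this
        exact this
    · simp [h] at ha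

/-- The nontrivial direction of the **Tutte–Berge formula** for the graph induced on `A`: there
is a set `W`, obtained from `A` by deleting few vertices, whose connected components (the fibres
of `c`) include many of odd order. -/
theorem exists_oddFibers {V : Type u} [LinearOrder V] (H : SimpleGraph V)
    (A : Finset V) (n : ℕ) (hA : 2 * n ≤ A.card) (hn : ¬ HasMatching H A n) :
    ∃ W ⊆ A, ∃ (ι : Type u) (_ : DecidableEq ι) (c : V → ι) (O : Finset ι),
      (∀ v ∈ W, ∀ w ∈ W, H.Adj v w → c v = c w) ∧
      2 * A.card + 2 ≤ O.card + W.card + 2 * n ∧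
      ∀ i ∈ O, Odd (W.filter (fun v => c v = i)).card := by
  classical
  obtain ⟨t, ht⟩ := Nat.exists_eq_add_of_le hA
  set K := joinComplete H A t with hK
  have hno : ¬ ∃ M : K.Subgraph, M.IsPerfectMatching := by
    rintro ⟨M, hM⟩
    exact hn (hasMatching_of_isPerfectMatching H A n t ht M hM)
  rw [SimpleGraph.tutte] at hno
  push Not at hno
  obtain ⟨u, hu⟩ := hno
  unfold SimpleGraph.IsTutteViolator at hu
  set D := (⊤ : K.Subgraph).deleteVerts u with hD
  have hverts : D.verts = uᶜ := by
    ext x; simp [hD]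
  have hDadj : ∀ x y : D.verts, D.coe.Adj x y ↔ K.Adj x y := by
    rintro ⟨x, hx⟩ ⟨y, hy⟩
    rw [hverts] at hx hy
    simp only [hD, SimpleGraph.Subgraph.coe_adj, SimpleGraph.Subgraph.deleteVerts_adj,
      SimpleGraph.Subgraph.top_adj, SimpleGraph.Subgraph.verts_top, Set.mem_univ, true_and]
    exact ⟨fun h => h.2.2, fun h => ⟨hx, hy, h⟩⟩
  have hcard : u.ncard + Nat.card D.verts = 2 * n + t + t := by
    rw [Nat.card_coe_set_eq, hverts, Set.ncard_add_ncard_compl, Nat.card_eq_fintype_card]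
    simp [ht]
  have hpar := SimpleGraph.odd_ncard_oddComponents (G := D.coe)
  -- The join has `2n + 2t` vertices, so the number of odd components has the parity of `|u|`, and
  -- exceeding `|u|` means exceeding it by 2.
  have hge : u.ncard + 2 ≤ D.coe.oddComponents.ncard := by
    rcases Nat.even_or_odd u.ncard with he | ho
    · have h1 : ¬ Odd (Nat.card D.verts) := by
        rw [Nat.not_odd_iff_even]
        obtain ⟨r, hr⟩ := he
        exact ⟨n + t - r, by omega⟩
      rw [← hpar, Nat.not_odd_iff_even] at h1
      obtain ⟨r, hr⟩ := he
      obtain ⟨r', hr'⟩ := h1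
      omega
    · have h1 : Odd (Nat.card D.verts) := by
        obtain ⟨r, hr⟩ := ho
        exact ⟨n + t - r - 1, by omega⟩
      rw [← hpar] at h1
      obtain ⟨r, hr⟩ := ho
      obtain ⟨r', hr'⟩ := h1
      omega
  -- A surviving added vertex would be adjacent to everything left, leaving at most one odd
  -- component instead of at least two.
  have hinr : ∀ k : Fin t, Sum.inr k ∈ u := by
    intro k
    by_contra hk
    have hk' : (Sum.inr k : A ⊕ Fin t) ∈ D.verts := by rw [hverts]; exact hk
    have hcomp : ∀ x : D.verts, D.coe.connectedComponentMk x =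
        D.coe.connectedComponentMk ⟨_, hk'⟩ := by
      intro x
      by_cases hx : (x : A ⊕ Fin t) = .inr k
      · congr 1
        exact Subtype.ext hx
      · apply SimpleGraph.ConnectedComponent.sound
        apply SimpleGraph.Adj.reachable
        rw [hDadj]
        exact joinComplete_adj_inr H A t _ k hx
    have : D.coe.oddComponents.ncard ≤ 1 := by
      rw [Set.ncard_le_one]
      intro a _ b _
      induction a using SimpleGraph.ConnectedComponent.ind with | _ a
      induction b using SimpleGraph.ConnectedComponent.ind with | _ b
      rw [hcomp a, hcomp b]
    omega
  have hmem : ∀ v (h : v ∈ A), Sum.inl (⟨v, h⟩ : A) ∉ u → Sum.inl (⟨v, h⟩ : A) ∈ D.verts := by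
    intro v h h'
    rw [hverts]; exact h'
  let W : Finset V := A.filter (fun v => ∃ h : v ∈ A, Sum.inl (⟨v, h⟩ : A) ∉ u)
  have hWA : W ⊆ A := Finset.filter_subset _ _
  have hWD : ∀ v ∈ W, ∃ h : v ∈ A, Sum.inl (⟨v, h⟩ : A) ∈ D.verts := by
    intro v hv
    obtain ⟨h, h'⟩ := (Finset.mem_filter.1 hv).2
    exact ⟨h, hmem v h h'⟩
  have hDW : ∀ x : D.verts, ∃ v, ∃ h : v ∈ A, (x : A ⊕ Fin t) = Sum.inl ⟨v, h⟩ ∧ v ∈ W := by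
    rintro ⟨x, hx⟩
    rw [hverts] at hx
    rcases x with ⟨v, h⟩ | k
    · exact ⟨v, h, rfl, Finset.mem_filter.2 ⟨h, h, hx⟩⟩
    · exact absurd (hinr k) hx
  let c : V → Option D.coe.ConnectedComponent := fun v =>
    if h : ∃ h : v ∈ A, Sum.inl (⟨v, h⟩ : A) ∈ D.verts then
      some (D.coe.connectedComponentMk ⟨_, h.2⟩) else none
  have hc : ∀ v (h : v ∈ A) (h' : Sum.inl (⟨v, h⟩ : A) ∈ D.verts),
      c v = some (D.coe.connectedComponentMk ⟨_, h'⟩) := by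
    intro v h h'
    exact dif_pos (⟨h, h'⟩ : ∃ h : v ∈ A, Sum.inl (⟨v, h⟩ : A) ∈ D.verts)
  have hfib : ∀ C : D.coe.ConnectedComponent,
      (W.filter (fun v => c v = some C)).card = C.supp.ncard := by
    intro C
    rw [← Set.ncard_coe_finset]
    symm
    refine Set.ncard_congr (fun x _ => (hDW x).choose) ?_ ?_ ?_
    · intro x hx
      obtain ⟨h, h1, h2⟩ := (hDW x).choose_spec
      simp only [Finset.coe_filter, Set.mem_ofPred_eq]
      refine ⟨h2, ?_⟩
      rw [hc _ h (h1 ▸ x.2), ← (SimpleGraph.ConnectedComponent.mem_supp_iff C x).1 hx]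
      congr 2
      exact Subtype.ext h1.symm
    · intro x y hx hy hxy
      obtain ⟨h, h1, h2⟩ := (hDW x).choose_spec
      obtain ⟨h', h1', h2'⟩ := (hDW y).choose_spec
      apply Subtype.ext
      rw [h1, h1']
      congr 2
    · intro v hv
      simp only [Finset.coe_filter, Set.mem_ofPred_eq] at hv
      obtain ⟨h, h'⟩ := hWD v hv.1
      refine ⟨⟨_, h'⟩, ?_, ?_⟩
      · rw [hc v h h'] at hv
        exact Option.some_injective _ hv.2
      · obtain ⟨h2, h3, h4⟩ := (hDW ⟨_, h'⟩).choose_spec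
        have := Sum.inl_injective h3
        exact (Subtype.ext_iff.1 this).symm
  have hWcard : W.card = Nat.card D.verts := by
    rw [Nat.card_coe_set_eq, ← Set.ncard_coe_finset]
    symm
    rw [← Set.ncard_univ D.verts |>.trans (Nat.card_coe_set_eq _)]
    refine Set.ncard_congr (fun x _ => (hDW x).choose) ?_ ?_ ?_
    · intro x _
      obtain ⟨h, h1, h2⟩ := (hDW x).choose_spec
      exact h2
    · intro x y _ _ hxy
      obtain ⟨h, h1, h2⟩ := (hDW x).choose_spec
      obtain ⟨h', h1', h2'⟩ := (hDW y).choose_spec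
      apply Subtype.ext
      rw [h1, h1']
      congr 2
    · intro v hv
      obtain ⟨h, h'⟩ := hWD v hv
      refine ⟨⟨_, h'⟩, Set.mem_univ _, ?_⟩
      obtain ⟨h2, h3, h4⟩ := (hDW ⟨_, h'⟩).choose_spec
      have := Sum.inl_injective h3
      exact (Subtype.ext_iff.1 this).symm
  refine ⟨W, hWA, Option D.coe.ConnectedComponent, inferInstance, c,
    (Set.toFinite D.coe.oddComponents).toFinset.map Function.Embedding.some, ?_, ?_, ?_⟩
  · intro v hv w hw hvw
    obtain ⟨h, h'⟩ := hWD v hv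
    obtain ⟨h1, h1'⟩ := hWD w hw
    rw [hc v h h', hc w h1 h1']
    congr 1
    apply SimpleGraph.ConnectedComponent.sound
    apply SimpleGraph.Adj.reachable
    rw [hDadj]
    exact hvw
  · rw [Finset.card_map, ← Set.ncard_eq_toFinset_card]
    omega
  · intro i hi
    simp only [Finset.mem_map, Set.Finite.mem_toFinset, Function.Embedding.some_apply] at hi
    obtain ⟨C, hC, rfl⟩ := hi
    rw [hfib]
    exact hC

/-! ### Large independent sets inside neighborhoods -/

/-- Numerical incompatibility of the Tutte–Berge bound with all odd components being large. -/
lemma false_of_large_fibers {a m E n ω k : ℤ} (hn : 1 ≤ n) (hm : n + 1 ≤ m) (hE : 0 ≤ E)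
    (ha : a = m + E) (h : 2 * n ^ 2 ≤ a * E) (hω : ω ≤ a) (hk : 2 * a + 2 ≤ k + ω + 2 * n)
    (h3 : 3 * k ≤ ω) (hd : k * (ω + 1 - m) ≤ ω) : False := by
  obtain ⟨s, rfl⟩ : ∃ s, ω = a - s := ⟨a - ω, by ring⟩
  obtain ⟨b, rfl⟩ : ∃ b, n = b + 1 := ⟨n - 1, by ring⟩
  have hs : 0 ≤ s := by linarith
  have h2n : 2 * (b + 1) ≤ a := by
    by_contra hlt
    push Not at hlt
    have hE' : E ≤ b - 1 := by linarith
    nlinarith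
  have hκ : a + s - 2 * b ≤ k := by linarith
  have hS : 0 ≤ 3 * b - a - 2 * s := by linarith
  have hEa : 4 * (b + 1) ≤ 2 * E + a := by
    by_contra hlt
    push Not at hlt
    nlinarith [sq_nonneg (2 * E - a)]
  have hmE : m = a - E := by linarith
  subst hmE
  -- With `s` vertices deleted, `E - s + 1` is the lower bound `ω + 1 - m` on a component's size.
  have hc : 0 ≤ E - s + 1 := by linarith
  have hg : (a + s - 2 * b) * (E - s + 1) ≤ a - s := by
    calc (a + s - 2 * b) * (E - s + 1) ≤ k * (E - s + 1) := by gcongr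
      _ = k * (a - s + 1 - (a - E)) := by ring
      _ ≤ a - s := hd
  have g0 : 0 < a * E - 2 * b * E - 2 * b := by
    rcases le_or_gt E b with hEb | hEb
    · nlinarith
    · nlinarith
  have gS : 0 < (a - b) * (2 * E + a - 3 * b - 4) := by
    apply mul_pos <;> linarith
  -- The quantity `(a + s - 2b)(E - s + 1) - (a - s)` is concave in `s`. The identity interpolates
  -- between its positive values at the ends `s = 0` (`g0`) and `s = (3b - a)/2` (`gS`).
  have key : 4 * (3 * b - a) * ((a + s - 2 * b) * (E - s + 1) - (a - s)) =
      4 * (3 * b - a - 2 * s) * (a * E - 2 * b * E - 2 * b) +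
      2 * s * ((a - b) * (2 * E + a - 3 * b - 4)) +
      2 * (3 * b - a) * s * (3 * b - a - 2 * s) := by ring
  have hpos : 0 ≤ 3 * b - a := by linarith
  rcases eq_or_lt_of_le hs with h0 | h0
  · subst h0
    nlinarith
  · have h1 : 0 ≤ 4 * (3 * b - a - 2 * s) * (a * E - 2 * b * E - 2 * b) := by positivity
    have h2 : 0 < 2 * s * ((a - b) * (2 * E + a - 3 * b - 4)) := by positivity
    have h3 : 0 ≤ 2 * (3 * b - a) * s * (3 * b - a - 2 * s) := by positivity
    have h4 : 4 * (3 * b - a) * ((a + s - 2 * b) * (E - s + 1) - (a - s)) ≤ 0 :=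
      mul_nonpos_of_nonneg_of_nonpos (by linarith) (by linarith)
    linarith

/-- In a dense graph on `A` without `n` disjoint edges there is a large independent set `J` inside
a set `W` which has an isolated vertex and in which every vertex has at most one neighbor
in `J`. -/
theorem exists_independent_of_not_hasMatching {V : Type*} [LinearOrder V] (H : SimpleGraph V)
    [DecidableRel H.Adj] (A : Finset V) {n m E : ℕ} (hn : 1 ≤ n) (hm : n < m)
    (hA : A.card = m + E) (hE : 2 * n ^ 2 ≤ (m + E) * E)
    (hdeg : ∀ w ∈ A, (A.filter (fun v => ¬ H.Adj w v)).card ≤ m) (hM : ¬ HasMatching H A n) :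
    ∃ W ⊆ A, ∃ J ⊆ W, ∃ z ∈ W, (∀ w ∈ W, ¬ H.Adj z w) ∧ (∀ v ∈ J, ∀ w ∈ J, ¬ H.Adj v w) ∧
      (∀ w ∈ W, (J.filter (fun v => H.Adj w v)).card ≤ 1) ∧
      2 * A.card + 2 ≤ J.card + W.card + 2 * n ∧ W.card ≤ m := by
  classical
  have h2n : 2 * n ≤ A.card := by
    by_contra hlt
    push Not at hlt
    have : E + 1 ≤ n := by omega
    nlinarith
  obtain ⟨W, hWA, ι, _, c, O, hc, hcard, hodd⟩ := exists_oddFibers H A n h2n hM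
  have hne : ∀ i ∈ O, ∃ w ∈ W, c w = i := by
    intro i hi
    have := (hodd i hi).pos
    obtain ⟨w, hw⟩ := Finset.card_pos.1 this
    exact ⟨w, (Finset.mem_filter.1 hw).1, (Finset.mem_filter.1 hw).2⟩
  -- The non-neighbors of `w` include `w` itself and all of `W` outside its fiber.
  have hnon : ∀ w ∈ W, W.card + 1 ≤ m + (W.filter (fun v => c v = c w)).card := by
    intro w hw
    have h1 : insert w (W.filter (fun v => ¬ c v = c w)) ⊆ A.filter (fun v => ¬ H.Adj w v) := by
      intro v hv
      rw [Finset.mem_insert, Finset.mem_filter] at hv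
      rw [Finset.mem_filter]
      rcases hv with rfl | ⟨hv, hvc⟩
      · exact ⟨hWA hw, H.loopless.irrefl _⟩
      · exact ⟨hWA hv, fun h => hvc (hc w hw v hv h).symm⟩
    have h2 := (Finset.card_le_card h1).trans (hdeg w (hWA hw))
    rw [Finset.card_insert_of_notMem (by simp)] at h2
    have := Finset.card_filter_add_card_filter_not (s := W) (fun v => c v = c w)
    omega
  have hsingle : ∃ i ∈ O, (W.filter (fun v => c v = i)).card = 1 := by
    by_contra hno
    push Not at hno
    have hsum : ∑ i ∈ O, (W.filter (fun v => c v = i)).card ≤ W.card := by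
      rw [← Finset.card_biUnion]
      · apply Finset.card_le_card
        intro v hv
        simp only [Finset.mem_biUnion, Finset.mem_filter] at hv
        obtain ⟨_, _, h, _⟩ := hv
        exact h
      · intro i _ j _ hij
        rw [Function.onFun, Finset.disjoint_left]
        intro v hv hv'
        exact hij ((Finset.mem_filter.1 hv).2.symm.trans (Finset.mem_filter.1 hv').2)
    have h3 : 3 * O.card ≤ W.card := by
      refine le_trans ?_ hsum
      rw [mul_comm, ← smul_eq_mul]
      apply Finset.card_nsmul_le_sum
      intro i hi
      obtain ⟨r, hr⟩ := hodd i hi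
      have := hno i hi
      omega
    have hd : (O.card : ℤ) * (W.card + 1 - m) ≤ W.card := by
      refine le_trans ?_ (Int.ofNat_le.2 hsum)
      push_cast
      rw [← nsmul_eq_mul]
      apply Finset.card_nsmul_le_sum
      intro i hi
      obtain ⟨w, hw, rfl⟩ := hne i hi
      have := hnon w hw
      omega
    refine false_of_large_fibers (a := A.card) (m := m) (E := E) (n := n) (ω := W.card)
      (k := O.card) (by exact_mod_cast hn) (by exact_mod_cast hm) (by positivity)
      (by exact_mod_cast hA) ?_ (by exact_mod_cast Finset.card_le_card hWA)
      (by exact_mod_cast hcard) (by exact_mod_cast h3) hd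
    rw [hA]
    exact_mod_cast hE
  obtain ⟨i, hi, hi1⟩ := hsingle
  obtain ⟨z, hz, rfl⟩ := hne i hi
  -- The independent set consists of one representative of each odd fiber.
  choose r hrW hrc using hne
  let g : O ↪ V := ⟨fun i => r i.1 i.2, fun i j h => by
    apply Subtype.ext
    have h' : r i.1 i.2 = r j.1 j.2 := h
    rw [← hrc i.1 i.2, ← hrc j.1 j.2, h']⟩
  have hJ : ∀ v ∈ Finset.univ.map g, v ∈ W ∧ ∀ w ∈ Finset.univ.map g, c v = c w → v = w := by
    intro v hv
    simp only [Finset.mem_map, Finset.mem_univ, true_and] at hv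
    obtain ⟨i, rfl⟩ := hv
    refine ⟨hrW _ _, ?_⟩
    intro w hw h
    simp only [Finset.mem_map, Finset.mem_univ, true_and] at hw
    obtain ⟨j, rfl⟩ := hw
    have : (i : ι) = j := by
      rw [← hrc i.1 i.2, ← hrc j.1 j.2]
      exact h
    rw [Subtype.ext this]
  refine ⟨W, hWA, Finset.univ.map g, fun v hv => (hJ v hv).1, z, hz, ?_, ?_, ?_, ?_, ?_⟩
  · intro w hw hzw
    obtain ⟨y, hy⟩ := Finset.card_eq_one.1 hi1
    have h1 : z ∈ W.filter (fun v => c v = c z) := by simp [hz]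
    have h2 : w ∈ W.filter (fun v => c v = c z) := by
      rw [Finset.mem_filter]
      exact ⟨hw, (hc z hz w hw hzw).symm⟩
    rw [hy, Finset.mem_singleton] at h1 h2
    exact hzw.ne (h1.trans h2.symm)
  · intro v hv w hw hvw
    exact hvw.ne ((hJ v hv).2 w hw (hc v (hJ v hv).1 w (hJ w hw).1 hvw))
  · intro w hw
    rw [Finset.card_le_one]
    intro x hx y hy
    rw [Finset.mem_filter] at hx hy
    exact (hJ x hx.1).2 y hy.1 ((hc w hw x (hJ x hx.1).1 hx.2).symm.trans
      (hc w hw y (hJ y hy.1).1 hy.2))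
  · rw [Finset.card_map, Finset.card_univ, Fintype.card_coe]
    exact hcard
  · have := hnon z hz
    omega

/-! ### Double counting between two independent sets -/

lemma hasMatching_of_pairs {V ι : Type*} (H : SimpleGraph V) (A : Finset V) {n : ℕ}
    (T : Finset ι) (hT : n ≤ T.card) (f g : ι → V) (hf : Function.Injective f)
    (hg : Function.Injective g) (hfg : ∀ i j, f i ≠ g j)
    (h : ∀ i ∈ T, f i ∈ A ∧ g i ∈ A ∧ H.Adj (f i) (g i)) : HasMatching H A n := by
  have hn : Fintype.card (Fin n) ≤ Fintype.card T := by simpa using hT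
  obtain ⟨e⟩ := Function.Embedding.nonempty_of_card_le hn
  refine ⟨fun q => if q.2 then g (e q.1) else f (e q.1), ?_, ?_, ?_⟩
  · rintro ⟨i, a⟩ ⟨j, b⟩ hab
    cases a <;> cases b <;> simp only [Bool.false_eq_true, if_false, if_true] at hab
    · rw [e.injective (Subtype.ext (hf hab))]
    · exact absurd hab (hfg _ _)
    · exact absurd hab.symm (hfg _ _)
    · rw [e.injective (Subtype.ext (hg hab))]
  · rintro ⟨i, a⟩
    cases a
    · simpa using (h _ (e i).2).1
    · simpa using (h _ (e i).2).2.1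
  · intro i
    simpa using (h _ (e i).2).2.2

/-- If `A` does not contain `n` disjoint edges, then the number of non-adjacent pairs between two
disjoint `p`-sets `I`, `J` is at least `p (|A ∩ I| + |A ∩ J| - p - n + 1)`: split the pairs into
`p` perfect matchings. -/
lemma card_inter_add_card_inter_le {V : Type*} [DecidableEq V] (H : SimpleGraph V)
    [DecidableRel H.Adj] (A I J : Finset V) {n p : ℕ} (hI : I.card = p) (hJ : J.card = p)
    (hIJ : Disjoint I J) (hM : ¬ HasMatching H A (n + 1)) :
    p * ((I.filter (· ∈ A)).card + (J.filter (· ∈ A)).card) ≤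
      p * (p + n) + ((I ×ˢ J).filter (fun q => ¬ H.Adj q.1 q.2)).card := by
  rcases Nat.eq_zero_or_pos p with rfl | hp
  · simp
  have : NeZero p := ⟨hp.ne'⟩
  have cI : Fintype.card (ZMod p) = Fintype.card I := by rw [ZMod.card, Fintype.card_coe, hI]
  have cJ : Fintype.card (ZMod p) = Fintype.card J := by rw [ZMod.card, Fintype.card_coe, hJ]
  let eI := Fintype.equivOfCardEq cI
  let eJ := Fintype.equivOfCardEq cJ
  have hX : (Finset.univ.filter (fun i => (eI i : V) ∈ A)).card = (I.filter (· ∈ A)).card := by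
    refine Finset.card_bij (fun i _ => (eI i : V)) ?_ ?_ ?_
    · intro i hi
      simpa using hi
    · intro i _ j _ h
      exact eI.injective (Subtype.ext h)
    · intro v hv
      rw [Finset.mem_filter] at hv
      exact ⟨eI.symm ⟨v, hv.1⟩, by simp [hv.2], by simp⟩
  have hY : ∀ k, (Finset.univ.filter (fun i => (eJ (i + k) : V) ∈ A)).card =
      (J.filter (· ∈ A)).card := by
    intro k
    refine Finset.card_bij (fun i _ => (eJ (i + k) : V)) ?_ ?_ ?_
    · intro i hi
      simpa using hi
    · intro i _ j _ h
      exact add_right_cancel (eJ.injective (Subtype.ext h))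
    · intro v hv
      rw [Finset.mem_filter] at hv
      exact ⟨eJ.symm ⟨v, hv.1⟩ - k, by simp [hv.2], by simp⟩
  -- The `k`-th matching pairs `eI i` with `eJ (i + k)`. At most `n` of its pairs can be adjacent
  -- with both ends in `A`.
  have hk : ∀ k : ZMod p, (I.filter (· ∈ A)).card + (J.filter (· ∈ A)).card ≤
      p + n + (Finset.univ.filter (fun i => ¬ H.Adj (eI i : V) (eJ (i + k)))).card := by
    intro k
    set X := Finset.univ.filter (fun i => (eI i : V) ∈ A)
    set Y := Finset.univ.filter (fun i => (eJ (i + k) : V) ∈ A)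
    set B := Finset.univ.filter (fun i => ¬ H.Adj (eI i : V) (eJ (i + k)))
    have h1 : (X ∪ Y).card ≤ p := by
      simpa [ZMod.card] using Finset.card_le_univ (X ∪ Y)
    have h2 := Finset.card_union_add_card_inter X Y
    have h3 : ((X ∩ Y) \ B).card ≤ n := by
      by_contra hlt
      push Not at hlt
      refine hM (hasMatching_of_pairs H A ((X ∩ Y) \ B) hlt (fun i => (eI i : V))
        (fun i => (eJ (i + k) : V)) ?_ ?_ ?_ ?_)
      · exact Subtype.val_injective.comp eI.injective
      · exact fun i j h => add_right_cancel (eJ.injective (Subtype.ext h))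
      · exact fun i j h => Finset.disjoint_left.1 hIJ (eI i).2 (h ▸ (eJ (j + k)).2)
      · intro i hi
        simpa [X, Y, B, and_assoc] using hi
    have h4 := Finset.card_le_card_sdiff_add_card (s := X ∩ Y) (t := B)
    have h5 : X.card = (I.filter (· ∈ A)).card := hX
    have h6 : Y.card = (J.filter (· ∈ A)).card := hY k
    omega
  have hsum : ∑ k : ZMod p, (Finset.univ.filter
      (fun i => ¬ H.Adj (eI i : V) (eJ (i + k)))).card =
      ((I ×ˢ J).filter (fun q => ¬ H.Adj q.1 q.2)).card := by
    rw [← Finset.card_sigma]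
    refine Finset.card_bij (fun q _ => ((eI q.2 : V), (eJ (q.2 + q.1) : V))) ?_ ?_ ?_
    · rintro ⟨k, i⟩ hi
      simpa using hi
    · rintro ⟨k, i⟩ _ ⟨l, j⟩ _ h
      simp only [Prod.mk.injEq] at h
      obtain rfl := eI.injective (Subtype.ext h.1)
      rw [add_left_cancel (eJ.injective (Subtype.ext h.2))]
    · rintro ⟨v, w⟩ hvw
      simp only [Finset.mem_filter, Finset.mem_product] at hvw
      refine ⟨⟨eJ.symm ⟨w, hvw.1.2⟩ - eI.symm ⟨v, hvw.1.1⟩, eI.symm ⟨v, hvw.1.1⟩⟩, ?_, ?_⟩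
      · simp [hvw.2]
      · simp
  calc p * ((I.filter (· ∈ A)).card + (J.filter (· ∈ A)).card)
      = ∑ _k : ZMod p, ((I.filter (· ∈ A)).card + (J.filter (· ∈ A)).card) := by
        simp [ZMod.card]
    _ ≤ ∑ k : ZMod p, (p + n + (Finset.univ.filter
          (fun i => ¬ H.Adj (eI i : V) (eJ (i + k)))).card) :=
        Finset.sum_le_sum fun k _ => hk k
    _ = _ := by
        rw [Finset.sum_add_distrib, hsum]
        simp [ZMod.card]

/-- Double counting: the degrees of the vertices of `I`. -/
lemma sum_card_filter_adj {V : Type*} [Fintype V] (H : SimpleGraph V) [DecidableRel H.Adj]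
    (I : Finset V) :
    ∑ v, (I.filter (fun y => H.Adj v y)).card = ∑ y ∈ I, (H.neighborFinset y).card := by
  simp only [Finset.card_filter, SimpleGraph.neighborFinset_eq_filter]
  rw [Finset.sum_comm]
  simp only [H.adj_comm]

/-- Arithmetic contradiction in the double counting of edges leaving two independent sets. -/
lemma false_of_count {d D b s σ p μ : ℤ} (hb : 0 ≤ b) (hD : 0 ≤ D)
    (h : 2 * (b + 1) ^ 2 ≤ d * D) (hs : D ≤ s) (hsb : s ≤ b) (hσ : D ≤ σ) (hσb : σ ≤ b)
    (hp : d + s - 2 * b ≤ p) (hμ : 0 ≤ μ)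
    (hcount : p * (2 * p * d) ≤ 2 * p * (p ^ 2 - μ) +
      (2 * d - s - σ - 2 * p) * (p + 1) * p + (s + σ - D) * (p * (p + b) + μ)) : False := by
  have hdD : 5 * b < 2 * (d + D) := by
    by_contra hlt
    push Not at hlt
    nlinarith [sq_nonneg (d - D)]
  have hp0 : 0 < p := by linarith
  -- Missing edges between the two independent sets only lower the upper count, so `μ` can be
  -- dropped.
  have hμc : (s + σ - D - 2 * p) * μ ≤ 0 :=
    mul_nonpos_of_nonpos_of_nonneg (by linarith) hμ
  have h1 : p * (2 * p * d) ≤ p * (2 * p ^ 2 + (2 * d - s - σ - 2 * p) * (p + 1) +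
      (s + σ - D) * (p + b)) := by linarith
  have h2 := le_of_mul_le_mul_left h1 hp0
  have h3 : (p + b) * D + 2 * p - 2 * d ≤ (b - 1) * (s + σ) := by linarith
  have h4 : (d + s - b) * D ≤ (p + b) * D := mul_le_mul_of_nonneg_right (by linarith) hD
  rcases eq_or_lt_of_le hb with rfl | hb'
  · nlinarith
  · have h5 : (b - 1) * (s + σ) ≤ (b - 1) * (s + b) :=
      mul_le_mul_of_nonneg_left (by linarith) (by linarith)
    have h6 : 0 ≤ (b - s) * (b - D) := mul_nonneg (by linarith) (by linarith)
    nlinarith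

lemma le_sum_card_filter_adj {V : Type*} [Fintype V] (H : SimpleGraph V) [DecidableRel H.Adj]
    (I : Finset V) {d : ℕ} (hd : ∀ v, d ≤ (H.neighborFinset v).card) :
    I.card * d ≤ ∑ v, (I.filter (fun y => H.Adj v y)).card := by
  rw [sum_card_filter_adj, ← smul_eq_mul]
  exact Finset.card_nsmul_le_sum _ _ _ fun y _ => hd y

/-- The double counting inequality for two independent sets `I`, `J` of size `p` inside disjoint
sets `W₁ ⊇ J`, `W₂ ⊇ I`. -/
lemma count_edges {V : Type*} [Fintype V] [DecidableEq V] (H : SimpleGraph V)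
    [DecidableRel H.Adj] {W₁ W₂ I J : Finset V} {b d p : ℕ}
    (hd : ∀ v, d ≤ (H.neighborFinset v).card)
    (hM : ∀ v, ¬ HasMatching H (H.neighborFinset v) (b + 1))
    (hW : Disjoint W₁ W₂) (hJW : J ⊆ W₁) (hIW : I ⊆ W₂) (hI : I.card = p) (hJ : J.card = p)
    (hIi : ∀ v ∈ I, ∀ w ∈ I, ¬ H.Adj v w) (hJi : ∀ v ∈ J, ∀ w ∈ J, ¬ H.Adj v w)
    (h₁ : ∀ w ∈ W₁, (J.filter (fun v => H.Adj w v)).card ≤ 1)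
    (h₂ : ∀ w ∈ W₂, (I.filter (fun v => H.Adj w v)).card ≤ 1) :
    ∃ μ : ℤ, 0 ≤ μ ∧ (p : ℤ) * (2 * p * d) ≤ 2 * p * (p ^ 2 - μ) +
      (W₁.card + W₂.card - 2 * p) * (p + 1) * p +
      (Fintype.card V - W₁.card - W₂.card) * (p * (p + b) + μ) := by
  set F : V → ℕ := fun v => (I.filter (fun y => H.Adj v y)).card +
    (J.filter (fun y => H.Adj v y)).card with hF
  have hIJ : Disjoint I J := (hW.mono hJW hIW).symm
  set μ := ((I ×ˢ J).filter (fun q => ¬ H.Adj q.1 q.2)).card with hμ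
  have hlow : 2 * p * d ≤ ∑ v, F v := by
    rw [hF, Finset.sum_add_distrib]
    have h1 := le_sum_card_filter_adj H I hd
    have h2 := le_sum_card_filter_adj H J hd
    rw [hI] at h1
    rw [hJ] at h2
    linarith
  have hadj : ((I ×ˢ J).filter (fun q => H.Adj q.1 q.2)).card + μ = p ^ 2 := by
    rw [hμ, Finset.card_filter_add_card_filter_not, Finset.card_product, hI, hJ, sq]
  have hFI : ∑ v ∈ I, F v + μ = p ^ 2 := by
    rw [← hadj, Finset.card_filter, Finset.sum_product, add_left_inj]
    refine Finset.sum_congr rfl fun v hv => ?_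
    have : I.filter (fun y => H.Adj v y) = ∅ :=
      Finset.filter_eq_empty_iff.2 fun y hy => hIi v hv y hy
    rw [hF]
    simp only [this, Finset.card_empty, zero_add, Finset.card_filter]
  have hFJ : ∑ v ∈ J, F v + μ = p ^ 2 := by
    rw [← hadj, Finset.card_filter, Finset.sum_product_right, add_left_inj]
    refine Finset.sum_congr rfl fun v hv => ?_
    have : J.filter (fun y => H.Adj v y) = ∅ :=
      Finset.filter_eq_empty_iff.2 fun y hy => hJi v hv y hy
    rw [hF]
    simp only [this, Finset.card_empty, add_zero, Finset.card_filter, H.adj_comm]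
  have hIle : ∀ v, (I.filter (fun y => H.Adj v y)).card ≤ p := fun v =>
    (Finset.card_filter_le _ _).trans hI.le
  have hJle : ∀ v, (J.filter (fun y => H.Adj v y)).card ≤ p := fun v =>
    (Finset.card_filter_le _ _).trans hJ.le
  have hF1 : ∑ v ∈ W₁ \ J, F v ≤ (W₁ \ J).card * (p + 1) := by
    rw [← smul_eq_mul]
    refine Finset.sum_le_card_nsmul _ _ _ fun v hv => ?_
    exact add_le_add (hIle v) (h₁ v (Finset.mem_sdiff.1 hv).1)
  have hF2 : ∑ v ∈ W₂ \ I, F v ≤ (W₂ \ I).card * (p + 1) := by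
    rw [← smul_eq_mul]
    refine Finset.sum_le_card_nsmul _ _ _ fun v hv => ?_
    rw [add_comm p]
    exact add_le_add (h₂ v (Finset.mem_sdiff.1 hv).1) (hJle v)
  -- The bound for outside vertices is an average over `p` matchings, hence the factor `p` carried
  -- through the count.
  have hFR : p * ∑ v ∈ Finset.univ \ (W₁ ∪ W₂), F v ≤
      (Finset.univ \ (W₁ ∪ W₂)).card * (p * (p + b) + μ) := by
    rw [Finset.mul_sum, ← smul_eq_mul]
    refine Finset.sum_le_card_nsmul _ _ _ fun v _ => ?_
    have := card_inter_add_card_inter_le H (H.neighborFinset v) I J hI hJ hIJ (hM v)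
    simpa only [SimpleGraph.mem_neighborFinset] using this
  have hsplit : ∑ v, F v = (∑ v ∈ W₁ \ J, F v + ∑ v ∈ J, F v) +
      (∑ v ∈ W₂ \ I, F v + ∑ v ∈ I, F v) + ∑ v ∈ Finset.univ \ (W₁ ∪ W₂), F v := by
    rw [Finset.sum_sdiff hJW, Finset.sum_sdiff hIW, ← Finset.sum_union hW, add_comm,
      Finset.sum_sdiff (Finset.subset_univ _)]
  have c1 := Finset.card_sdiff_add_card_eq_card hJW
  have c2 := Finset.card_sdiff_add_card_eq_card hIW
  have c3 := Finset.card_sdiff_add_card_eq_card (Finset.subset_univ (W₁ ∪ W₂))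
  rw [Finset.card_union_of_disjoint hW, Finset.card_univ] at c3
  refine ⟨μ, by positivity, ?_⟩
  generalize ∑ v ∈ W₁ \ J, F v = A1 at *
  generalize ∑ v ∈ W₂ \ I, F v = A2 at *
  generalize ∑ v ∈ J, F v = B1 at *
  generalize ∑ v ∈ I, F v = B2 at *
  generalize ∑ v ∈ Finset.univ \ (W₁ ∪ W₂), F v = R at *
  rw [hsplit] at hlow
  rw [hJ] at c1
  rw [hI] at c2
  zify at hlow hF1 hF2 hFR hFI hFJ c1 c2 c3
  rw [show ((W₁ \ J).card : ℤ) = W₁.card - p by linarith] at hF1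
  rw [show ((W₂ \ I).card : ℤ) = W₂.card - p by linarith] at hF2
  rw [show ((Finset.univ \ (W₁ ∪ W₂)).card : ℤ) = Fintype.card V - W₁.card - W₂.card by
    linarith] at hFR
  have hp : (0 : ℤ) ≤ p := by positivity
  have k0 := mul_le_mul_of_nonneg_left hlow hp
  have k1 := mul_le_mul_of_nonneg_left hF1 hp
  have k2 := mul_le_mul_of_nonneg_left hF2 hp
  have e1 : (B1 : ℤ) = p ^ 2 - μ := by linarith
  have e2 : (B2 : ℤ) = p ^ 2 - μ := by linarith
  rw [e1, e2] at k0
  linarith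

/-- The upper bound in terms of the second color: a first neighborhood supplies `W₁` and its
isolated vertex `z`, and the neighborhood of `z` supplies a disjoint `W₂`. -/
theorem exists_hasMatching_neighborFinset {V : Type*} [Fintype V] [LinearOrder V]
    (H : SimpleGraph V) [DecidableRel H.Adj] {n m D : ℕ} (hn : 1 ≤ n) (hm : n < m)
    (hV : Fintype.card V = 2 * m + D) (hD : 2 * n ^ 2 ≤ (m + D) * D)
    (hdeg : ∀ v, (Finset.univ.filter (fun w => ¬ H.Adj v w)).card ≤ m) :
    ∃ v, HasMatching H (H.neighborFinset v) n := by
  by_contra hM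
  push Not at hM
  have hd : ∀ v, m + D ≤ (H.neighborFinset v).card := by
    intro v
    have h1 := hdeg v
    have h2 := Finset.card_filter_add_card_filter_not (s := Finset.univ) (fun w => H.Adj v w)
    rw [Finset.card_univ, hV] at h2
    rw [SimpleGraph.neighborFinset_eq_filter]
    omega
  have hloc : ∀ v, ∃ W ⊆ H.neighborFinset v, ∃ J ⊆ W, ∃ z ∈ W, (∀ w ∈ W, ¬ H.Adj z w) ∧
      (∀ v ∈ J, ∀ w ∈ J, ¬ H.Adj v w) ∧
      (∀ w ∈ W, (J.filter (fun v => H.Adj w v)).card ≤ 1) ∧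
      2 * (m + D) + 2 ≤ J.card + W.card + 2 * n ∧ W.card ≤ m := by
    intro v
    -- A degree above `m + D` is absorbed by enlarging `D` to `D + e`.
    obtain ⟨e, he⟩ := Nat.exists_eq_add_of_le (hd v)
    obtain ⟨W, hW, J, hJ, z, hz, h1, h2, h3, h4, h5⟩ :=
      exists_independent_of_not_hasMatching H (H.neighborFinset v) (E := D + e) hn hm
        (by omega) (hD.trans (by gcongr <;> omega))
        (fun w _ => (Finset.card_le_card (Finset.filter_subset_filter _
          (Finset.subset_univ _))).trans (hdeg w)) (hM v)
    exact ⟨W, hW, J, hJ, z, hz, h1, h2, h3, by omega, h5⟩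
  have : Nonempty V := Fintype.card_pos_iff.1 (by omega)
  obtain ⟨x⟩ := this
  obtain ⟨W₁, hW₁, J', hJ', z, hz, hzW, hJi, hJ1, hJc, hW₁m⟩ := hloc x
  obtain ⟨W₂, hW₂, I', hI', -, -, -, hIi, hI1, hIc, hW₂m⟩ := hloc z
  have hW : Disjoint W₁ W₂ := by
    rw [Finset.disjoint_left]
    intro w h1 h2
    exact hzW w h1 ((H.mem_neighborFinset z w).1 (hW₂ h2))
  -- Both independent sets are cut to the smaller size, since splitting the pairs into perfect
  -- matchings needs equal sizes.
  obtain ⟨J, hJ, hJp⟩ := Finset.exists_subset_card_eq (min_le_right I'.card J'.card)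
  obtain ⟨I, hI, hIp⟩ := Finset.exists_subset_card_eq (min_le_left I'.card J'.card)
  obtain ⟨b, rfl⟩ : ∃ b, n = b + 1 := ⟨n - 1, by omega⟩
  obtain ⟨μ, hμ, hcount⟩ := count_edges H hd hM hW (hJ.trans hJ') (hI.trans hI') hIp hJp
    (fun v hv w hw => hIi v (hI hv) w (hI hw)) (fun v hv w hw => hJi v (hJ hv) w (hJ hw))
    (fun w hw => (Finset.card_le_card (Finset.filter_subset_filter _ hJ)).trans (hJ1 w hw))
    (fun w hw => (Finset.card_le_card (Finset.filter_subset_filter _ hI)).trans (hI1 w hw))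
  have hJ'W := Finset.card_le_card hJ'
  have hI'W := Finset.card_le_card hI'
  rw [hV] at hcount
  set p := min I'.card J'.card with hp
  have hD' : 2 * ((b : ℤ) + 1) ^ 2 ≤ (m + D) * D := by exact_mod_cast hD
  push_cast at hcount
  -- The deficit `s` must belong to the side whose independent set determined `p`.
  rcases le_total I'.card J'.card with hle | hle
  · have hpe : p = I'.card := min_eq_left hle
    refine false_of_count (d := m + D) (D := D) (b := b) (s := m + D - W₂.card)
      (σ := m + D - W₁.card) (p := p) (μ := μ) (by positivity) (by positivity) hD' ?_ ?_ ?_ ?_ ?_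
      hμ ?_ <;> first | omega | linarith
  · have hpe : p = J'.card := min_eq_right hle
    refine false_of_count (d := m + D) (D := D) (b := b) (s := m + D - W₁.card)
      (σ := m + D - W₂.card) (p := p) (μ := μ) (by positivity) (by positivity) hD' ?_ ?_ ?_ ?_ ?_
      hμ ?_ <;> first | omega | linarith

/-! ### Stars and fans as degree and neighborhood conditions -/

lemma starK_isContained_iff {V : Type*} [Fintype V] (G : SimpleGraph V) [DecidableRel G.Adj]
    (m : ℕ) : starK m ⊑ G ↔ ∃ v, m ≤ (Finset.univ.filter (fun w => G.Adj v w)).card := by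
  constructor
  · rintro ⟨f⟩
    refine ⟨f (.inl 0), ?_⟩
    calc m = (Finset.univ : Finset (Fin m)).card := by simp
      _ ≤ _ := by
        apply Finset.card_le_card_of_injOn (fun i => f (.inr i))
        · intro i _
          simp only [Finset.coe_filter, Finset.mem_univ, true_and, Set.mem_ofPred_eq]
          exact f.toHom.map_adj (by simp)
        · intro i _ j _ h
          exact Sum.inr_injective (f.injective h)
  · rintro ⟨v, hv⟩
    have hc : Fintype.card (Fin m) ≤
        Fintype.card (Finset.univ.filter (fun w => G.Adj v w)) := by
      simpa only [Fintype.card_fin, Fintype.card_coe] using hv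
    obtain ⟨e⟩ := Function.Embedding.nonempty_of_card_le hc
    have he : ∀ i, G.Adj v (e i) := fun i => (Finset.mem_filter.1 (e i).2).2
    refine ⟨⟨⟨Sum.elim (fun _ => v) (fun i => (e i : V)), ?_⟩, ?_⟩⟩
    · rintro (a | i) (b | j) h
      · simp at h
      · exact he j
      · exact (he i).symm
      · simp at h
    · rintro (a | i) (b | j) h
      · rw [Subsingleton.elim a b]
      · exact absurd h (he j).ne
      · exact absurd h (he i).ne'
      · rw [e.injective (Subtype.ext h)]

lemma fan_isContained_iff {V : Type*} [Fintype V] (H : SimpleGraph V) [DecidableRel H.Adj]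
    (n : ℕ) : fan n ⊑ H ↔ ∃ v, HasMatching H (H.neighborFinset v) n := by
  constructor
  · rintro ⟨f⟩
    refine ⟨f none, fun p => f (some p), ?_, ?_, ?_⟩
    · exact f.injective.comp (Option.some_injective _)
    · intro p
      rw [SimpleGraph.mem_neighborFinset]
      exact f.toHom.map_adj ⟨by simp, Or.inl rfl⟩
    · intro i
      exact f.toHom.map_adj ⟨by simp, Or.inr (Or.inr ⟨i, false, true, rfl, rfl⟩)⟩
  · rintro ⟨v, f, hf, hfv, hadj⟩
    simp only [SimpleGraph.mem_neighborFinset] at hfv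
    refine ⟨⟨⟨fun x => x.elim v f, ?_⟩, ?_⟩⟩
    · rintro (_ | p) (_ | q) ⟨hne, h⟩
      · exact absurd rfl hne
      · exact hfv q
      · exact (hfv p).symm
      · simp only [reduceCtorEq, Option.some.injEq, false_or] at h
        obtain ⟨i, a, b, rfl, rfl⟩ := h
        cases a <;> cases b
        · exact absurd rfl hne
        · exact hadj i
        · exact (hadj i).symm
        · exact absurd rfl hne
    · rintro (_ | p) (_ | q) h
      · rfl
      · exact absurd h (hfv q).ne
      · exact absurd h (hfv p).ne'
      · rw [hf h]

theorem ramseyArrow_of_le {m n D : ℕ} (hn : 1 ≤ n) (hm : n < m)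
    (hD : 2 * n ^ 2 ≤ (m + D) * D) : RamseyArrow (starK m) (fan n) (2 * m + D) := by
  classical
  intro G
  rw [or_iff_not_imp_left, starK_isContained_iff, fan_isContained_iff]
  intro hG
  push Not at hG
  refine exists_hasMatching_neighborFinset Gᶜ hn hm (by simp) hD fun v => ?_
  have h1 : Finset.univ.filter (fun w => ¬ Gᶜ.Adj v w) ⊆
      insert v (Finset.univ.filter (fun w => G.Adj v w)) := by
    intro w hw
    simp only [SimpleGraph.compl_adj, Finset.mem_filter, Finset.mem_univ, true_and, not_and,
      not_not, Finset.mem_insert] at hw ⊢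
    by_cases h : v = w
    · exact Or.inl h.symm
    · exact Or.inr (hw h)
  exact (Finset.card_le_card h1).trans ((Finset.card_insert_le _ _).trans (hG v))

/-- A 2-coloring of a larger complete graph also contains one of the two graphs. -/
lemma RamseyArrow.isContained_or {V W X : Type*} [Fintype X] {H₁ : SimpleGraph V}
    {H₂ : SimpleGraph W} {N : ℕ} (h : RamseyArrow H₁ H₂ N) (hN : N ≤ Fintype.card X)
    (G : SimpleGraph X) : H₁ ⊑ G ∨ H₂ ⊑ Gᶜ := by
  have hc : Fintype.card (Fin N) ≤ Fintype.card X := by simpa using hN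
  obtain ⟨e⟩ := Function.Embedding.nonempty_of_card_le hc
  rcases h (G.comap e) with h | h
  · exact Or.inl (h.trans ⟨⟨⟨e, fun h => h⟩, e.injective⟩⟩)
  · refine Or.inr (h.trans ⟨⟨⟨e, fun {a b} h => ?_⟩, e.injective⟩⟩)
    rw [SimpleGraph.compl_adj] at h ⊢
    exact ⟨fun h' => h.1 (e.injective h'), h.2⟩

/-! ### The extremal construction for the lower bound -/

/-- The `b + 1` disjoint edges of a fan would need `b + 1` distinct vertices of the cover `C`. -/
lemma not_fan_isContained_of_cover {V : Type*} [Fintype V] (H : SimpleGraph V) {b : ℕ}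
    (h : ∀ v, ∃ C : Finset V, C.card ≤ b ∧
      ∀ u w, H.Adj v u → H.Adj v w → H.Adj u w → u ∈ C ∨ w ∈ C) : ¬ fan (b + 1) ⊑ H := by
  classical
  rw [fan_isContained_iff]
  rintro ⟨v, f, hf, hfv, hadj⟩
  simp only [SimpleGraph.mem_neighborFinset] at hfv
  obtain ⟨C, hC, hcov⟩ := h v
  have : ∀ i, ∃ ε, f (i, ε) ∈ C := fun i => by
    rcases hcov _ _ (hfv _) (hfv _) (hadj i) with h | h
    · exact ⟨_, h⟩
    · exact ⟨_, h⟩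
  choose ε hε using this
  have : (Finset.univ : Finset (Fin (b + 1))).card ≤ C.card := by
    apply Finset.card_le_card_of_injOn (fun i => f (i, ε i)) (fun i _ => hε i)
    intro i _ j _ hij
    exact (Prod.mk.inj (hf hij)).1
  simp at this
  omega

/-- Almost biregular bipartite graphs. -/
lemma exists_biregular {P q b lo hi : ℕ} (hP : 0 < P) (hbP : b ≤ P) (hlo : P * lo ≤ q * b)
    (hhi : q * b ≤ P * hi) :
    ∃ B : Fin P → Fin q → Bool, (∀ y, (Finset.univ.filter (fun x => B x y)).card = b) ∧
      ∀ x, lo ≤ (Finset.univ.filter (fun y => B x y)).card ∧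
        (Finset.univ.filter (fun y => B x y)).card ≤ hi := by
  classical
  -- Deal `0, …, qb - 1` cyclically around `P` places, giving each `y` a block of `b` consecutive
  -- numbers. These hit distinct places as `b ≤ P`, and the loads of the places differ by at most
  -- one.
  refine ⟨fun x y => decide (∃ r < b, (y * b + r) % P = x), fun y => ?_, fun x => ?_⟩
  · conv_rhs => rw [← Finset.card_range b]
    symm
    refine Finset.card_bij (fun r _ => (⟨(y * b + r) % P, Nat.mod_lt _ hP⟩ : Fin P)) ?_ ?_ ?_
    · intro r hr
      simpa using ⟨r, Finset.mem_range.1 hr, rfl⟩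
    · intro r hr s hs h
      rw [Finset.mem_range] at hr hs
      have h' : (y * b + r) ≡ (y * b + s) [MOD P] := Fin.mk.inj_iff.1 h
      exact Nat.ModEq.eq_of_lt_of_lt (Nat.ModEq.add_left_cancel' _ h') (by omega) (by omega)
    · intro x hx
      simp only [decide_eq_true_eq, Finset.mem_filter, Finset.mem_univ, true_and] at hx
      obtain ⟨r, hr, hrx⟩ := hx
      exact ⟨r, Finset.mem_range.2 hr, Fin.ext hrx⟩
  · have hcard : (Finset.univ.filter (fun y : Fin q =>
        decide (∃ r < b, (y * b + r) % P = x) = true)).card =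
        (q * b).count (· ≡ x [MOD P]) := by
      rw [Nat.count_eq_card_filter_range]
      symm
      have hlt : ∀ k ∈ (Finset.range (q * b)).filter (· ≡ x [MOD P]), k / b < q := by
        intro k hk
        rw [Finset.mem_filter, Finset.mem_range] at hk
        exact Nat.div_lt_of_lt_mul (by rw [mul_comm]; exact hk.1)
      refine Finset.card_bij (fun k hk => (⟨k / b, hlt k hk⟩ : Fin q)) ?_ ?_ ?_
      · intro k hk
        rw [Finset.mem_filter, Finset.mem_range] at hk
        have hb : 0 < b := by
          rcases Nat.eq_zero_or_pos b with rfl | hb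
          · simp at hk
          · exact hb
        simp only [decide_eq_true_eq, Finset.mem_filter, Finset.mem_univ, true_and]
        refine ⟨k % b, Nat.mod_lt _ hb, ?_⟩
        rw [Nat.div_add_mod']
        exact Eq.trans hk.2 (Nat.mod_eq_of_lt x.2)
      · intro k hk l hl h
        rw [Finset.mem_filter, Finset.mem_range] at hk hl
        have hb : 0 < b := by
          rcases Nat.eq_zero_or_pos b with rfl | hb
          · simp at hk
          · exact hb
        have h1 : k / b = l / b := Fin.mk.inj_iff.1 h
        have h2 : k ≡ l [MOD P] := hk.2.trans hl.2.symm
        rw [← Nat.div_add_mod k b, ← Nat.div_add_mod l b, h1] at h2 ⊢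
        have h3 := Nat.ModEq.add_left_cancel' _ h2
        rw [Nat.ModEq.eq_of_lt_of_lt h3 ((Nat.mod_lt _ hb).trans_le hbP)
          ((Nat.mod_lt _ hb).trans_le hbP)]
      · intro y hy
        simp only [decide_eq_true_eq, Finset.mem_filter, Finset.mem_univ, true_and] at hy
        obtain ⟨r, hr, hrx⟩ := hy
        have hb : 0 < b := by omega
        refine ⟨y * b + r, ?_, ?_⟩
        · rw [Finset.mem_filter, Finset.mem_range]
          constructor
          · calc y * b + r < y * b + b := by omega
              _ = (y + 1) * b := by ring
              _ ≤ q * b := Nat.mul_le_mul_right _ y.2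
          · rw [Nat.ModEq, hrx, Nat.mod_eq_of_lt x.2]
        · apply Fin.ext
          change (y * b + r) / b = y
          rw [mul_comm, Nat.mul_add_div hb, Nat.div_eq_of_lt hr, add_zero]
    rw [hcard, Nat.count_modEq_card _ hP]
    have h1 := Nat.div_add_mod (q * b) P
    constructor
    · exact le_trans ((Nat.le_div_iff_mul_le hP).2 (by rwa [mul_comm])) (Nat.le_add_right _ _)
    · split_ifs with h
      · have : P * (q * b / P) < P * hi := by omega
        have := Nat.lt_of_mul_lt_mul_left this
        omega
      · rw [add_zero]
        exact Nat.div_le_of_le_mul hhi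

/-- Two copies of a bipartite graph `B`, with the first parts completely joined to both opposite
parts. -/
def doubledGraph {P q : ℕ} (B : Fin P → Fin q → Bool) :
    SimpleGraph (Bool × (Fin P ⊕ Fin q)) where
  Adj
    | (s, .inl _), (t, .inl _) => s ≠ t
    | (s, .inl x), (t, .inr y) => s ≠ t ∨ B x y
    | (s, .inr y), (t, .inl x) => s ≠ t ∨ B x y
    | (_, .inr _), (_, .inr _) => False
  symm := ⟨by
    rintro ⟨s, x | y⟩ ⟨t, x' | y'⟩ h
    · exact Ne.symm h
    · exact h.imp Ne.symm id
    · exact h.imp Ne.symm id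
    · exact h⟩
  loopless := ⟨by
    rintro ⟨s, x | y⟩ h
    · exact h rfl
    · exact h⟩

/-- Around a `P`-vertex, every edge of the neighborhood meets the opposite `q`-side or the vertex's
own `B`-neighbors. Around a `q`-vertex, the own `B`-neighbors suffice as a cover. -/
lemma not_fan_isContained_doubledGraph {P q b : ℕ} (B : Fin P → Fin q → Bool)
    (h₁ : ∀ y, (Finset.univ.filter (fun x => B x y)).card ≤ b)
    (h₂ : ∀ x, q + (Finset.univ.filter (fun y => B x y)).card ≤ b) :
    ¬ fan (b + 1) ⊑ doubledGraph B := by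
  apply not_fan_isContained_of_cover
  rintro ⟨s, x | y⟩
  · refine ⟨({!s} ×ˢ (∅ : Finset (Fin P)).disjSum Finset.univ) ∪ ({s} ×ˢ
      (∅ : Finset (Fin P)).disjSum (Finset.univ.filter (fun y => B x y))), ?_, ?_⟩
    · refine (Finset.card_union_le _ _).trans ?_
      simpa [Finset.card_product, Finset.card_disjSum] using h₂ x
    · rintro ⟨t, x' | y'⟩ ⟨t', x'' | y''⟩ h1 h2 h3 <;>
        simp [doubledGraph] at h1 h2 h3 ⊢ <;> cases s <;> cases t <;> cases t' <;> simp_all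
  · refine ⟨{s} ×ˢ (Finset.univ.filter (fun x => B x y)).disjSum ∅, ?_, ?_⟩
    · simpa [Finset.card_product, Finset.card_disjSum] using h₁ y
    · rintro ⟨t, x' | y'⟩ ⟨t', x'' | y''⟩ h1 h2 h3 <;>
        simp [doubledGraph] at h1 h2 h3 ⊢ <;> cases s <;> cases t <;> cases t' <;> simp_all

/-- The set `C` contains `v` itself, so `|C| ≤ m` leaves fewer than `m` neighbors in the complement.
-/
lemma not_starK_isContained_compl {V : Type*} [Fintype V] (H : SimpleGraph V) {m : ℕ}
    (h : ∀ v, ∃ C : Finset V, C.card ≤ m ∧ ∀ w, ¬ H.Adj v w → w ∈ C) : ¬ starK m ⊑ Hᶜ := by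
  classical
  rw [starK_isContained_iff]
  rintro ⟨v, hv⟩
  obtain ⟨C, hC, hcov⟩ := h v
  have h1 : insert v (Finset.univ.filter (fun w => Hᶜ.Adj v w)) ⊆ C := by
    intro w hw
    simp only [Finset.mem_insert, Finset.mem_filter, Finset.mem_univ, true_and,
      SimpleGraph.compl_adj] at hw
    rcases hw with rfl | hw
    · exact hcov _ (H.loopless.irrefl _)
    · exact hcov _ hw.2
  have h2 := Finset.card_le_card h1
  rw [Finset.card_insert_of_notMem (by simp)] at h2
  omega

lemma not_starK_isContained_doubledGraph {P q m : ℕ} (B : Fin P → Fin q → Bool)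
    (h₁ : ∀ y, P + 2 * q ≤ m + (Finset.univ.filter (fun x => B x y)).card)
    (h₂ : ∀ x, P + q ≤ m + (Finset.univ.filter (fun y => B x y)).card) :
    ¬ starK m ⊑ (doubledGraph B)ᶜ := by
  apply not_starK_isContained_compl
  rintro ⟨s, x | y⟩
  · refine ⟨{s} ×ˢ (Finset.univ : Finset (Fin P)).disjSum
      (Finset.univ.filter (fun y => ¬ B x y)), ?_, ?_⟩
    · have h := Finset.card_filter_add_card_filter_not (s := Finset.univ) (fun y => B x y = true)
      rw [Finset.card_univ, Fintype.card_fin] at h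
      have := h₂ x
      rw [Finset.card_product, Finset.card_disjSum, Finset.card_singleton, Finset.card_univ,
        Fintype.card_fin]
      omega
    · rintro ⟨t, x' | y'⟩ h <;> simp [doubledGraph] at h ⊢ <;> simp_all
  · refine ⟨(Finset.univ ×ˢ (∅ : Finset (Fin P)).disjSum Finset.univ) ∪
      ({s} ×ˢ (Finset.univ.filter (fun x => ¬ B x y)).disjSum ∅), ?_, ?_⟩
    · have h := Finset.card_filter_add_card_filter_not (s := Finset.univ) (fun x => B x y = true)
      rw [Finset.card_univ, Fintype.card_fin] at h
      have := h₁ y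
      refine (Finset.card_union_le _ _).trans ?_
      rw [Finset.card_product, Finset.card_disjSum, Finset.card_product, Finset.card_disjSum,
        Finset.card_singleton, Finset.card_univ, Finset.card_univ, Fintype.card_fin,
        Fintype.card_bool, Finset.card_empty, Finset.card_empty]
      omega
    · rintro ⟨t, x' | y'⟩ h <;> simp [doubledGraph] at h ⊢ <;> simp_all

/-- Parameters of the extremal construction. -/
lemma exists_parameters {m b : ℕ} (hb : 1 ≤ b) (hm : b + 2 ≤ m) :
    ∃ P q, b ≤ P ∧ q * (P + b) ≤ P * b ∧ P * b < (q + 1) * (P + b) ∧ P + 2 * q + 2 ≤ m + b ∧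
      2 * ((b : ℤ) + 1) ^ 2 < (2 * P + 2 * q + 9 - m) * (2 * P + 2 * q + 9 - 2 * m) ∧
      2 * m ≤ 2 * P + 2 * q + 9 := by
  obtain ⟨Q, hQ⟩ : ∃ Q : ℕ → ℕ, ∀ P, Q P * (P + b) ≤ P * b ∧ P * b < (Q P + 1) * (P + b) :=
    ⟨fun P => P * b / (P + b), fun P => ⟨Nat.div_mul_le_self _ _, by
      simpa only [mul_comm] using Nat.lt_mul_div_succ (P * b) (show 0 < P + b by omega)⟩⟩
  -- For each `P`, `Q P` is the largest `q` with average degree `qb/P ≤ b - q`. Then `P` is pushed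
  -- up until the next value would break `P + 2q + 2 ≤ m + b`. The spare 2 pays for rounding
  -- degrees.
  have hex : ∃ P, b ≤ P ∧ m + b < (P + 1) + 2 * Q (P + 1) + 2 := by
    refine ⟨m + b, Nat.le_add_left _ _, ?_⟩
    have := Nat.zero_le (Q (m + b + 1))
    linarith
  classical
  obtain ⟨hbP, hlt⟩ := Nat.find_spec hex
  have hmin := fun k => Nat.find_min hex (m := k)
  set P := Nat.find hex
  have hle : P + 2 * Q P + 2 ≤ m + b := by
    rcases Nat.eq_or_lt_of_le hbP with h | h
    · rw [← h]
      have := (hQ b).1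
      have : Q b * 2 ≤ b := by nlinarith
      omega
    · have := hmin (P - 1) (by omega)
      rw [Nat.sub_add_cancel (by omega)] at this
      push Not at this
      exact this (by omega)
  obtain ⟨h1, h2⟩ := hQ P
  obtain ⟨h3, h4⟩ := hQ (P + 1)
  generalize Q P = q at *
  generalize Q (P + 1) = q' at *
  have hqb : q ≤ b := by nlinarith
  have h2q : 2 * q ≤ P := by nlinarith
  have hq' : q' ≤ q + 1 := by
    by_contra hcon
    have h5 : q + 2 ≤ q' := by omega
    have : (q + 2) * (P + 1 + b) ≤ (P + 1) * b := le_trans (by gcongr) h3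
    nlinarith
  have hw : m + b ≤ P + 2 * q + 4 := by omega
  refine ⟨P, q, hbP, h1, h2, hle, ?_, by omega⟩
  -- Raising `P` by one raises `P + 2q` by at most 3, so the slack `w` is at most 4. The constant 9
  -- is chosen to keep `9 - 2w ≥ 1`.
  obtain ⟨w, hw1, hw2, hmw⟩ : ∃ w : ℤ, 2 ≤ w ∧ w ≤ 4 ∧ (m : ℤ) = P + 2 * q - b + w :=
    ⟨m + b - P - 2 * q, by omega, by omega, by ring⟩
  rw [hmw]
  zify at *
  have e1 : (2 * P + 2 * q + 9 - (P + 2 * q - b + w) : ℤ) = P + b + (9 - w) := by ring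
  have e2 : (2 * P + 2 * q + 9 - 2 * (P + 2 * q - b + w) : ℤ) = 2 * b - 2 * q + (9 - 2 * w) := by
    ring
  rw [e1, e2]
  have h5 : (b : ℤ) ^ 2 ≤ (P + b) * (b - q) := by linarith
  -- AM–GM applied to `h5`. This supplies the linear terms when `(P + b + 5)(2(b - q) + 1)` is
  -- expanded.
  have h6 : 4 * (b : ℤ) ≤ (P + b) + 10 * (b - q) := by
    by_contra hcon
    push Not at hcon
    nlinarith [sq_nonneg ((P + b : ℤ) - 10 * (b - q))]
  calc 2 * ((b : ℤ) + 1) ^ 2 < (P + b + 5) * (2 * b - 2 * q + 1) := by linarith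
    _ ≤ _ := by
      apply mul_le_mul <;> linarith

theorem exists_not_ramseyArrow {m n : ℕ} (hn : 2 ≤ n) (hm : n < m) :
    ∃ N : ℕ, (∀ N' ≤ N, ¬ RamseyArrow (starK m) (fan n) N') ∧ 2 * m ≤ N + 9 ∧
      2 * (n : ℤ) ^ 2 < (N + 9 - m) * (N + 9 - 2 * m) := by
  obtain ⟨b, rfl⟩ : ∃ b, n = b + 1 := ⟨n - 1, by omega⟩
  obtain ⟨P, q, hbP, h1, h2, h3, h4, h5⟩ := exists_parameters (m := m) (b := b) (by omega) hm
  have hqb : q ≤ b := by nlinarith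
  -- On the `P`-side, `lo` is what excluding the star requires and `hi` what excluding the fan
  -- allows. The lower bound uses the spare 2 together with `b ≤ P` and the maximality of `q`.
  obtain ⟨B, hB1, hB2⟩ := exists_biregular (P := P) (q := q) (b := b) (lo := P + q - m)
    (hi := b - q) (by omega) hbP
    (by
      rcases Nat.le_total (P + q) m with h | h
      · simp [Nat.sub_eq_zero_of_le h]
      · zify [h] at *
        nlinarith)
    (by
      zify [hqb] at *
      linarith)
  refine ⟨2 * P + 2 * q, fun N' hN' harrow => ?_, h5, by exact_mod_cast h4⟩
  have hcard : Fintype.card (Bool × (Fin P ⊕ Fin q)) = 2 * P + 2 * q := by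
    simp [mul_add]
  rcases harrow.isContained_or (hcard ▸ hN') (doubledGraph B)ᶜ with h | h
  · refine not_starK_isContained_doubledGraph B (fun y => ?_) (fun x => ?_) h
    · rw [hB1 y]; omega
    · have := (hB2 x).1; omega
  · rw [compl_compl] at h
    refine not_fan_isContained_doubledGraph B (fun y => (hB1 y).le) (fun x => ?_) h
    have := (hB2 x).2; omega

/-! ### Solving the quadratic for the explicit bounds -/

lemma ramseyNumber_starK_fan_bounds {m n : ℕ} (hn : 2 ≤ n) (hm : n < m) :
    IsLeast {N : ℕ | RamseyArrow (starK m) (fan n) N} (ramseyNumber (starK m) (fan n)) ∧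
      (3 * (m : ℝ) + √((m : ℝ) ^ 2 + 8 * (n : ℝ) ^ 2)) / 2 - 8
        < (ramseyNumber (starK m) (fan n) : ℝ) ∧
      (ramseyNumber (starK m) (fan n) : ℝ)
        < (3 * (m : ℝ) + √((m : ℝ) ^ 2 + 8 * (n : ℝ) ^ 2)) / 2 + 1 := by
  set S : ℝ := √((m : ℝ) ^ 2 + 8 * (n : ℝ) ^ 2) with hS
  have hS2 : S ^ 2 = (m : ℝ) ^ 2 + 8 * (n : ℝ) ^ 2 := Real.sq_sqrt (by positivity)
  have hmS : (m : ℝ) ≤ S := Real.le_sqrt_of_sq_le (by nlinarith [sq_nonneg (n : ℝ)])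
  have hup : RamseyArrow (starK m) (fan n) ⌈(3 * (m : ℝ) + S) / 2⌉₊ := by
    have hle := Nat.le_ceil ((3 * (m : ℝ) + S) / 2)
    have h2m : 2 * m ≤ ⌈(3 * (m : ℝ) + S) / 2⌉₊ := by
      have : ((2 * m : ℕ) : ℝ) ≤ ⌈(3 * (m : ℝ) + S) / 2⌉₊ := by push_cast; linarith
      exact_mod_cast this
    obtain ⟨D, hD⟩ := Nat.exists_eq_add_of_le h2m
    rw [hD] at hle ⊢
    push_cast at hle
    refine ramseyArrow_of_le (by omega) hm ?_
    have h1 : S ≤ m + 2 * D := by linarith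
    have h2 : S ^ 2 ≤ (m + 2 * D : ℝ) ^ 2 := by gcongr
    have h3 : (2 * n ^ 2 : ℝ) ≤ (m + D) * D := by nlinarith
    exact_mod_cast h3
  -- The infimum is attained only because `hup` shows the set to be nonempty; `sInf ∅` would be 0.
  have hmem : ramseyNumber (starK m) (fan n) ∈ {N : ℕ | RamseyArrow (starK m) (fan n) N} :=
    Nat.sInf_mem ⟨_, hup⟩
  refine ⟨⟨hmem, fun N hN => Nat.sInf_le hN⟩, ?_, ?_⟩
  · obtain ⟨N, hN, h2m, hlt⟩ := exists_not_ramseyArrow hn hm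
    have hNR : N + 1 ≤ ramseyNumber (starK m) (fan n) := by
      by_contra hcon
      exact hN _ (by omega) hmem
    have hNR' : (N : ℝ) + 1 ≤ ramseyNumber (starK m) (fan n) := by exact_mod_cast hNR
    have h2m' : 2 * (m : ℝ) ≤ N + 9 := by exact_mod_cast h2m
    have hlt' : 2 * (n : ℝ) ^ 2 < (N + 9 - m) * (N + 9 - 2 * m) := by exact_mod_cast hlt
    have hm0 : (0 : ℝ) ≤ m := by positivity
    -- Completing the square in `(X - m)(X - 2m) > 2n²` with `X = N + 9`. Since the Ramsey number is
    -- at least `N + 1`, the loss is 8.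
    have : S < 2 * (N + 9) - 3 * m := by
      apply lt_of_pow_lt_pow_left₀ 2 (by linarith)
      nlinarith
    linarith
  · refine lt_of_le_of_lt (Nat.cast_le.2 (Nat.sInf_le hup)) ?_
    exact Nat.ceil_lt_add_one (by positivity)

theorem theorem2 :
    (∀ m n : ℕ, 2 ≤ n → n < m →
      IsLeast {N : ℕ | RamseyArrow (starK m) (fan n) N} (ramseyNumber (starK m) (fan n)) ∧
      (3 * (m : ℝ) + √((m : ℝ) ^ 2 + 8 * (n : ℝ) ^ 2)) / 2 - 8
        < (ramseyNumber (starK m) (fan n) : ℝ) ∧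
      (ramseyNumber (starK m) (fan n) : ℝ)
        < (3 * (m : ℝ) + √((m : ℝ) ^ 2 + 8 * (n : ℝ) ^ 2)) / 2 + 1) ∧
    (∀ n : ℕ, 2 ≤ n →
      (3 + √(3 : ℝ)) * (n : ℝ) - 8 < (ramseyNumber (starK (2 * n)) (fan n) : ℝ) ∧
      (ramseyNumber (starK (2 * n)) (fan n) : ℝ) < (3 + √(3 : ℝ)) * (n : ℝ) + 1) := by
  refine ⟨fun m n hn hm => ramseyNumber_starK_fan_bounds hn hm, fun n hn => ?_⟩
  obtain ⟨-, h1, h2⟩ := ramseyNumber_starK_fan_bounds hn (show n < 2 * n by omega)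
  have hs : √(((2 * n : ℕ) : ℝ) ^ 2 + 8 * (n : ℝ) ^ 2) = 2 * n * √3 := by
    rw [show ((2 * n : ℕ) : ℝ) ^ 2 + 8 * (n : ℝ) ^ 2 = (2 * n) ^ 2 * 3 by push_cast; ring,
      Real.sqrt_mul (by positivity), Real.sqrt_sq (by positivity)]
  rw [hs] at h1 h2
  push_cast at h1 h2
  constructor <;> linarith
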